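/- Let $\mathbb{F}_q$ be a finite field with $q=p^r$ elements. The range of a polynomial $f\in\mathbb{F}_q[x]$ is the multiset $\{f(x) : x\in\mathbb{F}_q\}$ of size $q$, in which each value is counted with its multiplicity. For every integer $\ell$ with $\frac{q}{2}\le \ell<q-3$ there exists a multiset $M$ of $q$ elements of $\mathbb{F}_q$ such that $\sum_{b\in M} b=0$, the highest multiplicity of an element of $M$ is $\ell$ and it is attained at $0\in M$, and every polynomial over $\mathbb{F}_q$ whose range is $M$ has degree greater than $\ell$. -/

import Mathlib

open Polynomial

/-- The range of a polynomial `f` over a finite field `F`, as a multiset: the values `f(x)`, for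
`x` running through `F`, counted with multiplicity. -/
def polynomialRange {F : Type*} [Field F] [Fintype F] (f : F[X]) : Multiset F :=
  (Finset.univ : Finset F).val.map fun x => f.eval x

/-!
The proof counts. Write `q = |F| = ℓ + k + 2`, so that `k ≥ 2`, and consider the lists
`(b₀, b₁, b : Fin k → F)` of `k + 2` nonzero elements of `F` with sum zero. There are at least
`(q - 1) ^ k * (q - 2)` of them: choose `b` freely, then `b₁` different from `0` and `-∑ b`; this
determines `b₀`. Each list, padded with `ℓ` zeros, is a multiset of the required kind; since
`q / 2 ≤ ℓ`, no multiplicity exceeds `ℓ`.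

If such a multiset is the range of a polynomial of degree at most `ℓ`, the values of the list are
taken at distinct points `t₀, t₁, t : Fin k → F`, and the polynomial vanishes elsewhere. An affine
substitution, which changes neither the range nor the bound on the degree, moves `t₀` and `t₁` to
`0` and `1` (`exists_normalized_polynomial`). The polynomial has degree at most `ℓ` and its `ℓ`
zeros are given by `t`, so it is determined by `t` and its value at `0`
(`eq_of_eval_zero_of_zeros`), and so is the list. Hence at most
`(q - 1) * (q - 2) * (q - 3) * ⋯ * (q - k - 1) ≤ (q - 1) * (q - 2) ^ k` lists arise. For `k ≥ 2`
this is less than `(q - 1) ^ k * (q - 2)`, so some list does not arise.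
-/

/-- The element of `Fin ℓ ⊕ Option (Option (Fin k)) → F` that lists `ℓ` zeros, then `b₀`, `b₁` and
the values of `b`. -/
def paddedList {F : Type*} [Zero F] (ℓ : ℕ) {k : ℕ} (b₀ b₁ : F) (b : Fin k → F) :
    Fin ℓ ⊕ Option (Option (Fin k)) → F :=
  Sum.elim (fun _ => 0) fun o => o.elim b₀ fun o' => o'.elim b₁ b

theorem exists_multiset_of_list {F : Type*} [Field F] [Fintype F] [DecidableEq F] {ℓ k : ℕ}
    (hcard : Fintype.card F = ℓ + k + 2) (hℓ : k + 2 ≤ ℓ) {b₀ b₁ : F} {b : Fin k → F}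
    (h₀ : b₀ ≠ 0) (h₁ : b₁ ≠ 0) (hb : ∀ i, b i ≠ 0) (hsum : b₀ + (b₁ + ∑ i, b i) = 0) :
    ∃ M : Multiset F, M = Finset.univ.val.map (paddedList ℓ b₀ b₁ b) ∧
      Multiset.card M = Fintype.card F ∧ M.sum = 0 ∧ M.count 0 = ℓ ∧ ∀ x, M.count x ≤ ℓ := by
  have hsplit : Finset.univ.val.map (paddedList ℓ b₀ b₁ b) =
      Multiset.replicate ℓ 0 + (b₀ ::ₘ b₁ ::ₘ Finset.univ.val.map b) := by
    rw [← Finset.univ_disjSum_univ, Finset.val_disjSum, Multiset.disjSum, Multiset.map_add,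
      Multiset.map_map, Multiset.map_map]
    congr 1
    · simp [paddedList, Function.comp_def]
    · have hoption : ∀ (α : Type) [Fintype α], (Finset.univ : Finset (Option α)).val =
          none ::ₘ Finset.univ.val.map some := fun α _ => rfl
      rw [hoption, hoption, Multiset.map_cons, Multiset.map_cons, Multiset.map_cons,
        Multiset.map_map, Multiset.map_map]
      rfl
  have hzero : (b₀ ::ₘ b₁ ::ₘ Finset.univ.val.map b).count 0 = 0 := by
    refine Multiset.count_eq_zero.2 fun h => ?_
    rw [Multiset.mem_cons, Multiset.mem_cons, Multiset.mem_map] at h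
    rcases h with h | h | ⟨i, -, hi⟩
    exacts [h₀ h.symm, h₁ h.symm, hb i hi]
  refine ⟨_, rfl, ?_, ?_, ?_, fun x => ?_⟩
  · simp [hcard, add_assoc]
  · rw [hsplit, Multiset.sum_add, Multiset.sum_cons, Multiset.sum_cons, Multiset.sum_replicate,
      smul_zero, zero_add]
    exact hsum
  · rw [hsplit, Multiset.count_add, hzero, Multiset.count_replicate_self, add_zero]
  · rw [hsplit, Multiset.count_add]
    by_cases hx : x = 0
    · rw [hx, hzero, Multiset.count_replicate_self, add_zero]
    · rw [Multiset.count_replicate, if_neg (Ne.symm hx), zero_add]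
      refine (Multiset.count_le_card _ _).trans ?_
      rwa [Multiset.card_cons, Multiset.card_cons, Multiset.card_map, Finset.card_val,
        Finset.card_univ, Fintype.card_fin]

theorem exists_equiv_of_map_univ_eq {α β γ : Type*} [Fintype α] [Fintype β] {f : α → γ}
    {g : β → γ} (h : Finset.univ.val.map f = Finset.univ.val.map g) :
    ∃ e : β ≃ α, ∀ i, f (e i) = g i := by
  classical
  have hfiber : ∀ c, Nonempty ({b // g b = c} ≃ {a // f a = c}) := fun c => by
    refine Fintype.card_eq.1 ?_
    have := congrArg (Multiset.count c) h
    rw [Multiset.count_map, Multiset.count_map] at this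
    simp only [eq_comm (a := c)] at this
    rw [Fintype.card_subtype, Fintype.card_subtype]
    exact this.symm
  exact ⟨Equiv.ofFiberEquiv fun c => (hfiber c).some, Equiv.ofFiberEquiv_map _⟩

/-- If the range of a polynomial consists of `ℓ` zeros and a list `b₀, b₁, b`, then an affine
substitution makes it take the value `b₀` at `0`, `b₁` at `1`, and the values of `b` at distinct
further points `t`, all its other values being zero. -/
theorem exists_normalized_polynomial {F : Type*} [Field F] [Fintype F] {ℓ k : ℕ}
    {b₀ b₁ : F} {b : Fin k → F} {f : F[X]}
    (hf : polynomialRange f = Finset.univ.val.map (paddedList ℓ b₀ b₁ b))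
    (hdeg : f.natDegree ≤ ℓ) :
    ∃ (t : Fin k ↪ {x : F // x ≠ 0 ∧ x ≠ 1}) (g : F[X]), g.natDegree ≤ ℓ ∧ g.eval 0 = b₀ ∧
      g.eval 1 = b₁ ∧ (∀ i, g.eval (t i : F) = b i) ∧
      ∀ x, x ≠ 0 → x ≠ 1 → (∀ i, (t i : F) ≠ x) → g.eval x = 0 := by
  -- `e` lists the elements of `F` in the order of their values.
  obtain ⟨e, he⟩ := exists_equiv_of_map_univ_eq (f := fun x => f.eval x) hf
  set t₀ := e (Sum.inr none) with ht₀
  set t₁ := e (Sum.inr (some none)) with ht₁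
  have hne : t₁ - t₀ ≠ 0 := sub_ne_zero.2 fun h => by simpa using e.injective h
  have haff : ∀ y, (t₁ - t₀) * ((y - t₀) / (t₁ - t₀)) + t₀ = y := fun y => by
    field_simp; ring
  let t : Fin k → F := fun i => (e (Sum.inr (some (some i))) - t₀) / (t₁ - t₀)
  have ht : ∀ i, (t₁ - t₀) * t i + t₀ = e (Sum.inr (some (some i))) := fun i => haff _
  have ht0 : ∀ i, t i ≠ 0 := fun i h => by
    have := ht i
    rw [h, mul_zero, zero_add] at this
    simpa using e.injective this
  have ht1 : ∀ i, t i ≠ 1 := fun i h => by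
    have := ht i
    rw [h, mul_one, sub_add_cancel] at this
    simpa using e.injective this
  have htinj : Function.Injective t := fun i j h => by
    have := ht i
    rw [h, ht j] at this
    simpa using (e.injective this).symm
  have heval : ∀ x, (f.comp (C (t₁ - t₀) * X + C t₀)).eval x = f.eval ((t₁ - t₀) * x + t₀) :=
    fun x => by simp
  refine ⟨⟨fun i => ⟨t i, ht0 i, ht1 i⟩, fun i j h => htinj (congrArg Subtype.val h)⟩,
    f.comp (C (t₁ - t₀) * X + C t₀), ?_, ?_, ?_, fun i => ?_, fun x hx0 hx1 hx => ?_⟩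
  · rwa [natDegree_comp, natDegree_linear hne, mul_one]
  · rw [heval, mul_zero, zero_add, ht₀, he]
    rfl
  · rw [heval, mul_one, sub_add_cancel, ht₁, he]
    rfl
  · rw [heval]
    change f.eval ((t₁ - t₀) * t i + t₀) = b i
    rw [ht, he]
    rfl
  · rw [heval]
    have hy : ∀ y, (t₁ - t₀) * x + t₀ = (t₁ - t₀) * y + t₀ → x = y := fun y h =>
      mul_left_cancel₀ hne (add_right_cancel h)
    obtain ⟨j, hj⟩ := e.surjective ((t₁ - t₀) * x + t₀)
    rcases j with j | _ | _ | j
    · rw [← hj, he]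
      rfl
    · exact absurd (hy 0 (by rw [← hj, mul_zero, zero_add])) hx0
    · exact absurd (hy 1 (by rw [← hj, mul_one, sub_add_cancel])) hx1
    · exact absurd (hy (t j) (by rw [← hj, ht])).symm (hx j)

theorem eq_of_eval_zero_of_zeros {F : Type*} [Field F] [Fintype F] {ℓ k : ℕ}
    (hcard : Fintype.card F = ℓ + k + 2) (t : Fin k ↪ {x : F // x ≠ 0 ∧ x ≠ 1}) {g h : F[X]}
    (hg : g.natDegree ≤ ℓ) (hh : h.natDegree ≤ ℓ) (h0 : g.eval 0 = h.eval 0)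
    (hgz : ∀ x, x ≠ 0 → x ≠ 1 → (∀ i, (t i : F) ≠ x) → g.eval x = 0)
    (hhz : ∀ x, x ≠ 0 → x ≠ 1 → (∀ i, (t i : F) ≠ x) → h.eval x = 0) : g = h := by
  classical
  -- `g` and `h` agree off the `k + 1` points `1` and `t i`, hence at `ℓ + 1` points.
  let s : Finset F := insert 1 (Finset.univ.image fun i => (t i : F))
  have hs : s.card ≤ k + 1 := (Finset.card_insert_le _ _).trans
    (Nat.succ_le_succ (Finset.card_image_le.trans (by simp)))
  have hsc : ℓ < sᶜ.card := by
    rw [Finset.card_compl]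
    omega
  refine eq_of_natDegree_lt_card_of_eval_eq' g h sᶜ (fun x hx => ?_)
    ((max_le hg hh).trans_lt hsc)
  simp only [s, Finset.mem_compl, Finset.mem_insert, Finset.mem_image, Finset.mem_univ, true_and,
    not_or, not_exists] at hx
  by_cases hx0 : x = 0
  · rw [hx0, h0]
  · rw [hgz x hx0 hx.1 hx.2, hhz x hx0 hx.1 hx.2]

theorem card_le_card_ne_and_ne {F : Type*} [Fintype F] [DecidableEq F] (a c : F) :
    Fintype.card F - 2 ≤ Fintype.card {x : F // x ≠ a ∧ x ≠ c} := by
  rw [Fintype.card_subtype]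
  have h : (Finset.univ.filter fun x : F => x ≠ a ∧ x ≠ c) = ({a, c} : Finset F)ᶜ := by
    ext x
    simp
  rw [h, Finset.card_compl]
  have := Finset.card_le_two (a := a) (b := c)
  omega

theorem theorem3 {F : Type*} [Field F] [Fintype F] [DecidableEq F] (ℓ : ℕ)
    (hℓ : (Fintype.card F : ℚ) / 2 ≤ (ℓ : ℚ)) (hℓ' : (ℓ : ℚ) < (Fintype.card F : ℚ) - 3) :
    ∃ M : Multiset F,
      Multiset.card M = Fintype.card F ∧
      M.sum = 0 ∧
      M.count 0 = ℓ ∧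
      (∀ b : F, M.count b ≤ ℓ) ∧
      ∀ f : F[X], polynomialRange f = M → ℓ < f.natDegree := by
  have hlow : Fintype.card F ≤ 2 * ℓ := by
    have : (Fintype.card F : ℚ) ≤ 2 * ℓ := by linarith
    exact_mod_cast this
  have hupp : ℓ + 3 < Fintype.card F := by
    have : (ℓ : ℚ) + 3 < Fintype.card F := by linarith
    exact_mod_cast this
  obtain ⟨k, hcard⟩ : ∃ k, Fintype.card F = ℓ + k + 2 :=
    ⟨Fintype.card F - ℓ - 2, by omega⟩
  by_contra! hcon
  -- The lists: `b`, then `b₁ ∉ {0, -∑ b}`; the sum condition gives `b₀ = -(b₁ + ∑ b)`.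
  let L := Σ b : Fin k → Fˣ, {x : F // x ≠ 0 ∧ x ≠ -∑ i, (b i : F)}
  have hne : ∀ s : L, -((s.2 : F) + ∑ i, (s.1 i : F)) ≠ 0 := fun s h =>
    s.2.2.2 (eq_neg_of_add_eq_zero_left (neg_eq_zero.1 h))
  have key : ∀ s : L, ∃ (t : Fin k ↪ {x : F // x ≠ 0 ∧ x ≠ 1}) (g : F[X]), g.natDegree ≤ ℓ ∧
      g.eval 0 = -((s.2 : F) + ∑ i, (s.1 i : F)) ∧ g.eval 1 = s.2 ∧
      (∀ i, g.eval (t i : F) = s.1 i) ∧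
      ∀ x, x ≠ 0 → x ≠ 1 → (∀ i, (t i : F) ≠ x) → g.eval x = 0 := fun s => by
    obtain ⟨M, hM, hM1, hM2, hM3, hM4⟩ := exists_multiset_of_list hcard (by omega) (hne s)
      s.2.2.1 (fun i => (s.1 i).ne_zero) (neg_add_cancel _)
    obtain ⟨f, hf, hdeg⟩ := hcon M hM1 hM2 hM3 hM4
    exact exists_normalized_polynomial (hf.trans hM) hdeg
  choose t g hg hg0 hg1 hgt hgz using key
  have hinj : Function.Injective fun s : L => (Units.mk0 _ (hne s), t s) := by
    rintro ⟨b, x⟩ ⟨b', x'⟩ h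
    obtain ⟨h1, h2⟩ := Prod.mk.inj h
    have h3 := congrArg Units.val h1
    simp only [Units.val_mk0] at h3
    have hgg := eq_of_eval_zero_of_zeros hcard (t ⟨b, x⟩) (hg _) (hg ⟨b', x'⟩)
      (by rw [hg0, hg0]; exact h3) (hgz _) (by rw [h2]; exact hgz _)
    obtain rfl : b = b' := by
      ext i
      have e1 := hgt ⟨b, x⟩ i
      have e2 := hgt ⟨b', x'⟩ i
      rw [← h2, ← hgg, e1] at e2
      exact e2
    obtain rfl : x = x' := by
      ext
      have e1 := hg1 ⟨b, x⟩
      have e2 := hg1 ⟨b, x'⟩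
      rw [← hgg, e1] at e2
      exact e2
    rfl
  have hle := Fintype.card_le_of_injective _ hinj
  obtain ⟨n, hn⟩ : ∃ n, Fintype.card F = n + 2 := ⟨ℓ + k, hcard⟩
  have hunits : Fintype.card Fˣ = n + 1 := by rw [Fintype.card_units, hn]; rfl
  have hlists : (n + 1) ^ k * n ≤ Fintype.card L := by
    rw [Fintype.card_sigma]
    calc (n + 1) ^ k * n = ∑ _b : Fin k → Fˣ, n := by simp [hunits]
      _ ≤ _ := Finset.sum_le_sum fun b _ => by
        have := card_le_card_ne_and_ne (0 : F) (-∑ i, (b i : F))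
        rwa [hn] at this
  have hsub : Fintype.card {x : F // x ≠ 0 ∧ x ≠ 1} = n := by
    rw [Fintype.card_subtype]
    have h : (Finset.univ.filter fun x : F => x ≠ 0 ∧ x ≠ 1) = ({0, 1} : Finset F)ᶜ := by
      ext x
      simp
    rw [h, Finset.card_compl, Finset.card_pair zero_ne_one, hn]
    rfl
  rw [Fintype.card_prod, Fintype.card_embedding_eq, hunits, hsub, Fintype.card_fin] at hle
  have hbound : (n + 1) ^ k * n ≤ (n + 1) * n ^ k :=
    hlists.trans (hle.trans (Nat.mul_le_mul_left _ (Nat.descFactorial_le_pow n k)))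
  obtain ⟨j, rfl⟩ : ∃ j, k = j + 1 := ⟨k - 1, by omega⟩
  have hlt : n ^ j < (n + 1) ^ j := Nat.pow_lt_pow_left n.lt_succ_self (by omega)
  have hpos : 0 < (n + 1) * n := Nat.mul_pos n.succ_pos (by omega)
  have := Nat.mul_lt_mul_of_pos_left hlt hpos
  rw [pow_succ, pow_succ] at hbound
  nlinarith
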